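/- Consider a finite extensive-form game with a finite set $\mathcal P$ of players, chance moves, general payoffs $u_i$ on the terminal nodes $Z$, and perfect recall. Write $\mathcal I_i$ for the infosets of player $i$, $A(I)$ for the actions at $I$, $\Pi_i=\prod_{I\in\mathcal I_i}A(I)$ for her plans, $\Pi=\prod_i\Pi_i$, $\Pi_i(I)$ for the plans that reach $I$ whenever the others allow it, $\Pi_i(\sigma)=\{\pi_i\in\Pi_i(I):\pi_i(I)=a\}$ for $\sigma=(I,a)$, $\Pi_i(z)$ for the plans with which $i$ plays all her actions on the path to the node $z$, $Z(I)$ and $Z(I,a)$ for the terminal nodes reachable from $I$, resp. from $I$ by playing $a$, $p_c(z)$ for the product of the chance probabilities on the path to $z$, $\mathcal C(I,a)$ for the infosets of $i$ that immediately follow $I$ after $a$, and $\Sigma_i^c(I)$ for the set of $(J,a)$ such that $J\in\mathcal I_i$ strictly precedes $I$, $a\in A(J)$, and $I$ cannot be reached after playing $a$ at $J$. A distribution $\mu$ on $\Pi$ is an $\epsilon$-EFCE (an EFCE, if $\epsilon=0$) if for all $i$, all $\sigma=(I,a)$ with $I\in\mathcal I_i$, $a\in A(I)$, and all distributions $\hat\mu_i$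 on $\Pi_i(I)$, $$\sum_{z\in Z(I,a)}\Big(\sum_{\pi\in\Pi(z)}\mu(\pi)\Big)p_c(z)u_i(z)\ \ge\ \sum_{z\in Z(I)}\Big(\sum_{\pi_i\in\Pi_i(\sigma),\,\pi_{-i}\in\Pi_{-i}(z)}\mu(\pi)\Big)\Big(\sum_{\hat\pi_i\in\Pi_i(z)}\hat\mu_i(\hat\pi_i)\Big)p_c(z)u_i(z)-\epsilon .$$ ICFR for player $i$ has, for every $I\in\mathcal I_i$, one randomized internal-regret minimizer $\mathcal R^{\rm int}_I$ and, for every $\sigma\in\Sigma_i^c(I)$, one randomized external-regret minimizer $\mathcal R^{\rm ext}_{\sigma,I}$, all with decision set $A(I)$. In round $t$ the plan $\pi_i^t$ is sampled top-down: if the actions sampled so far allow $I$ to be reached, then $\pi_i^t(I)$ is recommended by $\mathcal R^{\rm int}_I$; otherwise it is recommended by $\mathcal R^{\rm ext}_{\sigma,I}$ for the unique $\sigma\in\Sigma_i^c(I)$ with $\pi_i^t\in\Pi_i(\sigma)$. All these samplings are independent given the past. With $\pi^t=(\pi^t_j)_{j}$, $$u_i^t[I,a]=\sum_{z\in Z(I,a)\setminus\bigcup_{J\in\mathcal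 C(I,a)}Z(J)}\mathbf 1[\pi_{-i}^t\in\Pi_{-i}(z)]\,p_c(z)u_i(z),\qquad V_I^t=\hat u_I^t(\pi_i^t(I)),\qquad \hat u_I^t(a)=u_i^t[I,a]+\sum_{J\in\mathcal C(I,a)}V_J^t,$$ $\mathcal R^{\rm int}_I$ then observes the utility $\mathbf 1[\pi_i^t\in\Pi_i(I)]\,\hat u_I^t$, and $\mathcal R^{\rm ext}_{\sigma,I}$ observes $\mathbf 1[\pi_i^t\in\Pi_i(\sigma)]\,\hat u_I^t$. Suppose that all players run ICFR, where the local devices minimize their cumulative regrets: almost surely, for each of them, $\limsup_{T\to\infty}R^T/T\le 0$, where, with $v^t$ the utilities observed by the device and $x^t=\pi_i^t(I)$, $R^T$ is the internal regret $\max_{x,\hat x}\sum_{t\le T}\mathbf 1[x^t=x](v^t(\hat x)-v^t(x))$ for $\mathcal R^{\rm int}_I$ and the external regret $\max_{\hat x}\sum_{t\le T}v^t(\hat x)-\sum_{t\le T}v^t(x^t)$ for $\mathcal R^{\rm ext}_{\sigma,I}$. Then the set of EFCEs is nonempty, and almost surely the empirical frequency of play $\bar\mu^T(\pi)=|\{t\le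 T:\pi^t=\pi\}|/T$ converges to it: the distance of $\bar\mu^T$ to the set of EFCEs tends to $0$, and for every $\epsilon>0$ the distribution $\bar\mu^T$ is an $\epsilon$-EFCE for all large $T$. -/

import Mathlib

open Filter Topology MeasureTheory

noncomputable section

/-- Labels of the decision nodes: `none` for a node of chance, `some ⟨i, I⟩` for a node in the
infoset `I` of player `i`.  A node is the list of the actions leading to it from the root,
with the most recent action first; thus `a :: h` is the child of `h` reached by action `a`, and
`h <:+ k` says that `h` lies on the path from the root to `k`.

`experience label i h` is the list of pairs (infoset, action) that player `i` meets and plays on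
the path from the root to `h`. -/
def experience {P : Type*} {Info : P → Type*} {Act : Type*}
    (label : List Act → Option (Σ i, Info i)) (i : P) : List Act → List ((Σ i, Info i) × Act)
  | [] => []
  | a :: h =>
    open Classical in
    match label h with
    | none => experience label i h
    | some J => if J.1 = i then (J, a) :: experience label i h else experience label i h

open Classical in
/-- A finite extensive-form game with chance moves, imperfect information and perfect recall,
with players `P`, infosets `Info i` of player `i`, and actions taken from `Act`. -/
structure EFG (P : Type*) (Info : P → Type*) (Act : Type*) where
  /-- The nodes of the game tree. -/
  nodes : Finset (List Act)
  root_mem : [] ∈ nodes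
  parent_mem : ∀ a h, a :: h ∈ nodes → h ∈ nodes
  /-- Who acts at a nonterminal node, and in which infoset (irrelevant at other lists). -/
  label : List Act → Option (Σ i, Info i)
  /-- The actions available at an infoset. -/
  avail : ∀ i, Info i → Finset Act
  infoset_nonempty : ∀ i (I : Info i), ∃ h, (∃ a, a :: h ∈ nodes) ∧ label h = some ⟨i, I⟩
  avail_iff : ∀ i (I : Info i) h, (∃ a, a :: h ∈ nodes) → label h = some ⟨i, I⟩ →
    ∀ a, a ∈ avail i I ↔ a :: h ∈ nodes
  /-- `chanceProb (a :: h)` is the probability that chance plays `a` at its node `h`. -/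
  chanceProb : List Act → ℝ
  chance_pos : ∀ a h, a :: h ∈ nodes → label h = none → 0 < chanceProb (a :: h)
  chance_sum : ∀ h, (∃ a, a :: h ∈ nodes) → label h = none →
    ∑ k ∈ nodes.filter (fun k => ∃ a, k = a :: h), chanceProb k = 1
  /-- The payoffs at the terminal nodes (irrelevant at other lists). -/
  payoff : P → List Act → ℝ
  perfect_recall : ∀ i (I : Info i) h k,
    (∃ a, a :: h ∈ nodes) → label h = some ⟨i, I⟩ →
    (∃ a, a :: k ∈ nodes) → label k = some ⟨i, I⟩ →
    experience label i h = experience label i k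

namespace EFG

variable {P : Type*} {Info : P → Type*} {Act : Type*}

section Tree

variable (G : EFG P Info Act) {i : P}

/-- The node `h` belongs to the infoset `I`. -/
def InInfoset (I : Info i) (h : List Act) : Prop :=
  (∃ a, a :: h ∈ G.nodes) ∧ G.label h = some ⟨i, I⟩

/-- The actions `A(I)` available at `I`. -/
abbrev Choice (I : Info i) : Type _ := {a : Act // a ∈ G.avail i I}

open Classical in
/-- The terminal nodes `Z`. -/
def terminals : Finset (List Act) := G.nodes.filter fun z => ∀ a, a :: z ∉ G.nodes

open Classical in
/-- `Z(I)`: the terminal nodes reachable from `I`. -/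
def terminalsFrom (I : Info i) : Finset (List Act) :=
  G.terminals.filter fun z => ∃ h, G.InInfoset I h ∧ h <:+ z

open Classical in
/-- `Z(I, a)`: the terminal nodes reachable by playing `a` at `I`. -/
def terminalsVia (I : Info i) (a : G.Choice I) : Finset (List Act) :=
  G.terminals.filter fun z => ∃ h, G.InInfoset I h ∧ (a.1 :: h) <:+ z

open Classical in
/-- `p_c`: the product of the probabilities of the chance moves on the path to a node. -/
def chanceReach : List Act → ℝ
  | [] => 1
  | a :: h => (if G.label h = none then G.chanceProb (a :: h) else 1) * chanceReach h

/-- `I` precedes `J` (weakly). -/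
def Precedes (I J : Info i) : Prop :=
  ∃ h k, G.InInfoset I h ∧ G.InInfoset J k ∧ h <:+ k

/-- `J` is in `C(I, a)`: it is reached from a node of `I` by a path that begins with the action
`a` and meets no other node of the same player before `J`. -/
def IsSucc (I : Info i) (a : G.Choice I) (J : Info i) : Prop :=
  ∃ h k, G.InInfoset I h ∧ G.InInfoset J k ∧ (a.1 :: h) <:+ k ∧
    ∀ m, (a.1 :: h) <:+ m → m <:+ k → m ≠ k → ∀ K : Info i, ¬ G.InInfoset K m

open Classical in
/-- `C(I, a)`: the infosets of player `i` that immediately follow `I` by playing `a`. -/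
def succs [Fintype (Info i)] (I : Info i) (a : G.Choice I) : Finset (Info i) :=
  Finset.univ.filter fun J => G.IsSucc I a J

/-- The normal-form plans `Π_i` of player `i`. -/
def Plan (i : P) : Type _ := ∀ I : Info i, G.Choice I

/-- The joint normal-form plans `Π`. -/
def JointPlan : Type _ := ∀ i : P, G.Plan i

instance [Fintype (Info i)] : Fintype (G.Plan i) := by
  classical
  unfold Plan
  infer_instance

instance [Fintype P] [∀ i, Fintype (Info i)] : Fintype G.JointPlan := by
  classical
  unfold JointPlan
  infer_instance

variable {G}

/-- The plan prescribes every action of its player on the path to the node `h`.  For a terminal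
node `z` this is membership in `Π_i(z)`. -/
def Plan.PlaysTo (π : G.Plan i) (h : List Act) : Prop :=
  ∀ (I : Info i) k a, G.InInfoset I k → (a :: k) <:+ h → (π I).1 = a

/-- Membership in `Π_i(I)`: the plan plays so as to reach `I` whenever possible. -/
def Plan.Reaches (π : G.Plan i) (I : Info i) : Prop :=
  ∃ h, G.InInfoset I h ∧ π.PlaysTo h

/-- Membership in `Π_i(σ)` for the sequence `σ = (I, a)`. -/
def Plan.ReachesVia (π : G.Plan i) (I : Info i) (a : G.Choice I) : Prop :=
  π.Reaches I ∧ π I = a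

/-- `π_{-i} ∈ Π_{-i}(z)`. -/
def JointPlan.OpponentsPlayTo (π : G.JointPlan) (i : P) (z : List Act) : Prop :=
  ∀ j, j ≠ i → (π j).PlaysTo z

end Tree

/-! ### The infosets of a player are well-founded -/

section WellFounded

variable (G : EFG P Info Act) {i : P}

theorem experience_suffix (label : List Act → Option (Σ i, Info i)) (i : P)
    {h k : List Act} (hk : h <:+ k) : experience label i h <:+ experience label i k := by
  obtain ⟨l, rfl⟩ := hk
  induction l with
  | nil => exact List.suffix_refl _
  | cons a l ih =>
    rw [List.cons_append, experience]
    split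
    · exact ih
    · split
      · exact ih.trans (List.suffix_cons _ _)
      · exact ih

theorem experience_cons {I : Info i} {h : List Act} (hI : G.InInfoset I h) (a : Act) :
    experience G.label i (a :: h) = (⟨i, I⟩, a) :: experience G.label i h := by
  rw [experience, hI.2]
  simp

theorem experience_length_le (label : List Act → Option (Σ i, Info i)) (i : P) (h : List Act) :
    (experience label i h).length ≤ h.length := by
  induction h with
  | nil => simp [experience]
  | cons a h ih =>
    rw [experience]
    split
    · exact ih.trans (by simp)
    · split
      · simpa using ih
      · exact ih.trans (by simp)

/-- The number of own actions that lead to an infoset. -/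
def rank (I : Info i) : ℕ :=
  (experience G.label i (G.infoset_nonempty i I).choose).length

theorem rank_eq {I : Info i} {h : List Act} (hI : G.InInfoset I h) :
    G.rank I = (experience G.label i h).length := by
  have hc := (G.infoset_nonempty i I).choose_spec
  rw [rank, G.perfect_recall i I _ h hc.1 hc.2 hI.1 hI.2]

/-- The height of the game tree. -/
def height : ℕ := G.nodes.sup List.length

theorem rank_le_height (I : Info i) : G.rank I ≤ G.height := by
  obtain ⟨h, hI⟩ := G.infoset_nonempty i I
  rw [G.rank_eq (I := I) hI]
  obtain ⟨a, ha⟩ := hI.1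
  exact (experience_length_le _ _ _).trans
    (Finset.le_sup (f := List.length) (G.parent_mem a h ha))

theorem rank_lt_of_isSucc {I J : Info i} {a : G.Choice I} (hJ : G.IsSucc I a J) :
    G.rank I < G.rank J := by
  obtain ⟨h, k, hI, hk, hs, -⟩ := hJ
  have := (experience_suffix G.label i hs).length_le
  rw [G.experience_cons hI, List.length_cons] at this
  rw [G.rank_eq hI, G.rank_eq hk]
  omega

end WellFounded

/-! ### Extensive-form correlated equilibria -/

section Equilibrium

variable [Fintype P] [∀ i, Fintype (Info i)] (G : EFG P Info Act)

open Classical in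
/-- `q_μ(z)`: the probability of reaching `z` when all recommendations are followed. -/
def reachProb (μ : G.JointPlan → ℝ) (z : List Act) : ℝ :=
  (∑ π with ∀ j, (π j).PlaysTo z, μ π) * G.chanceReach z

open Classical in
/-- `p^σ_{μ,μ'}(z)`: the probability of reaching `z` after the trigger agent of player `i` for
the sequence `σ = (I, a)` got triggered and plays a plan sampled from `μ'`. -/
def triggerProb (μ : G.JointPlan → ℝ) {i : P} (I : Info i) (a : G.Choice I)
    (μ' : G.Plan i → ℝ) (z : List Act) : ℝ :=
  (∑ π with (π i).ReachesVia I a ∧ π.OpponentsPlayTo i z, μ π) *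
    (∑ π' with π'.PlaysTo z, μ' π') * G.chanceReach z

/-- `μ` is an `ε`-EFCE: a distribution over joint plans such that no trigger agent, for any
sequence `(I, a)` of any player `i` and any distribution `μ'` over `Π_i(I)`, gains more than
`ε`. -/
def IsApproxEFCE (ε : ℝ) (μ : G.JointPlan → ℝ) : Prop :=
  μ ∈ stdSimplex ℝ G.JointPlan ∧
  ∀ (i : P) (I : Info i) (a : G.Choice I), ∀ μ' ∈ stdSimplex ℝ (G.Plan i),
    (∀ π', ¬ π'.Reaches I → μ' π' = 0) →
    ∑ z ∈ G.terminalsVia I a, G.reachProb μ z * G.payoff i z ≥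
      ∑ z ∈ G.terminalsFrom I, G.triggerProb μ I a μ' z * G.payoff i z - ε

/-- The set of extensive-form correlated equilibria. -/
def efceSet : Set (G.JointPlan → ℝ) := {μ | G.IsApproxEFCE 0 μ}

open Classical in
/-- The empirical frequency of play after the first `T` rounds. -/
def empiricalFrequency (play : ℕ → G.JointPlan) (T : ℕ) : G.JointPlan → ℝ :=
  fun π => (((Finset.range T).filter fun t => play t = π).card : ℝ) / T

end Equilibrium

/-! ### Local utilities -/

section Utilities

variable [∀ i, Fintype (Info i)] (G : EFG P Info Act) {i : P}

open Classical in
/-- The immediate utility `u_i[I, a]` when the players select `π`. -/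
def immediateUtility (π : G.JointPlan) (I : Info i) (a : G.Choice I) : ℝ :=
  ∑ z ∈ (G.terminalsVia I a).filter
      (fun z => ∀ J ∈ G.succs I a, z ∉ G.terminalsFrom J),
    (if π.OpponentsPlayTo i z then 1 else 0) * G.chanceReach z * G.payoff i z

/-- `V_I(π')`: the utility attainable at `I` by the plan `π'` of player `i` when the opponents
play as in `π`. -/
def infosetValue (π : G.JointPlan) (π' : G.Plan i) (I : Info i) : ℝ :=
  G.immediateUtility π I (π' I) +
    ∑ J ∈ (G.succs I (π' I)).attach, infosetValue π π' J.1
termination_by G.height - G.rank I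
decreasing_by
  have hJ : G.IsSucc I (π' I) J.1 := by
    have := J.2
    simp only [succs, Finset.mem_filter] at this
    exact this.2
  have h1 := G.rank_lt_of_isSucc hJ
  have h2 := G.rank_le_height J.1
  omega

/-- The utility of playing `a` at `I` and following `π i` at the subsequent infosets. -/
def localUtility (π : G.JointPlan) (I : Info i) (a : G.Choice I) : ℝ :=
  G.immediateUtility π I a + ∑ J ∈ G.succs I a, G.infosetValue π (π i) J

end Utilities

end EFG

/-! ### Regret minimizers -/

/-- A (randomized) regret minimizer with decision set `A`: it maps its own past to the law of its
next recommendation.  The past is a list with one entry per past round, oldest first: the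
recommendation it made in that round (`none` if it was not asked for one), and the utility
function it observed at the end of that round. -/
structure RegretMinimizer (A : Type*) where
  recommend : List (Option A × (A → ℝ)) → PMF A

open Classical in
/-- The cumulative external regret of the first `T` decisions `x t` on the utilities `u t`. -/
def externalRegret {A : Type*} (x : ℕ → A) (u : ℕ → A → ℝ) (T : ℕ) : ℝ :=
  (⨆ a : A, ∑ t ∈ Finset.range T, u t a) - ∑ t ∈ Finset.range T, u t (x t)

open Classical in
/-- The cumulative internal regret of the first `T` decisions `x t` on the utilities `u t`. -/
def internalRegret {A : Type*} (x : ℕ → A) (u : ℕ → A → ℝ) (T : ℕ) : ℝ :=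
  ⨆ ab : A × A, ∑ t ∈ Finset.range T, if x t = ab.1 then u t ab.2 - u t ab.1 else 0

/-- The cumulative regret is asymptotically sublinear: `limsup R T / T ≤ 0`. -/
def NoRegret (R : ℕ → ℝ) : Prop := ∀ ε : ℝ, 0 < ε → ∀ᶠ T in atTop, R T ≤ ε * (T : ℝ)

namespace EFG

/-! ### Internal counterfactual regret minimization -/

section ICFR

variable {P : Type*} {Info : P → Type*} {Act : Type*}

section Cut

variable (G : EFG P Info Act) {i : P}

/-- The sequence `(J, a)` belongs to `Σ_i^c(I)`: its last action is played at an infoset `J`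
that strictly precedes `I`, and it does not lead to `I`. -/
def IsCut (I J : Info i) (a : G.Choice J) : Prop :=
  G.Precedes J I ∧ J ≠ I ∧ ¬ ∃ h k, G.InInfoset J h ∧ G.InInfoset I k ∧ (a.1 :: h) <:+ k

variable {G}

/-- Two nodes of the same infoset on a common path are equal. -/
theorem eq_of_inInfoset_of_suffix {J : Info i} {h h' k : List Act} (hh : G.InInfoset J h)
    (hh' : G.InInfoset J h') (hk : h <:+ k) (hk' : h' <:+ k) : h = h' := by
  have key : ∀ {m m' : List Act}, G.InInfoset J m → G.InInfoset J m' → m <:+ m' → m = m' := by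
    intro m m' hm hm' hs
    by_contra hne
    obtain ⟨l, rfl⟩ := hs
    rcases List.eq_nil_or_concat l with rfl | ⟨l, b, rfl⟩
    · exact hne (by simp)
    · have hs : (b :: m) <:+ (l.concat b ++ m) := ⟨l, by simp⟩
      have h1 := (experience_suffix G.label i hs).length_le
      rw [G.experience_cons hm, List.length_cons, ← G.rank_eq hm, ← G.rank_eq hm'] at h1
      omega
  rcases List.suffix_or_suffix_of_suffix hk hk' with h1 | h1
  · exact key hh hh' h1
  · exact (key hh' hh h1).symm

theorem mem_experience_of_node {J : Info i} {a : Act} {h k : List Act} (hJ : G.InInfoset J h)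
    (hs : (a :: h) <:+ k) : ((⟨i, J⟩ : Σ i, Info i), a) ∈ experience G.label i k := by
  refine (experience_suffix G.label i hs).subset ?_
  rw [G.experience_cons hJ]
  simp

theorem node_of_mem_experience {J : Info i} {a : Act} {k : List Act} (hk : k ∈ G.nodes)
    (hm : ((⟨i, J⟩ : Σ i, Info i), a) ∈ experience G.label i k) :
    ∃ h, G.InInfoset J h ∧ (a :: h) <:+ k := by
  induction k with
  | nil => simp [experience] at hm
  | cons b k ih =>
    have hk' := G.parent_mem b k hk
    have lift : (∃ h, G.InInfoset J h ∧ (a :: h) <:+ k) →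
        ∃ h, G.InInfoset J h ∧ (a :: h) <:+ b :: k :=
      fun ⟨h, h1, h2⟩ => ⟨h, h1, h2.trans (List.suffix_cons _ _)⟩
    rw [experience] at hm
    split at hm
    · exact lift (ih hk' hm)
    · rename_i K hK
      split at hm
      · rcases List.mem_cons.1 hm with h1 | h1
        · obtain ⟨h2, h3⟩ := Prod.mk.injEq .. ▸ h1
          subst h3
          exact ⟨k, ⟨⟨a, hk⟩, by rw [hK, h2]⟩, List.suffix_refl _⟩
        · exact lift (ih hk' h1)
      · exact lift (ih hk' hm)

/-- If a plan does not reach `I`, then it plays some sequence in `Σ_i^c(I)`. -/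
theorem exists_cut (π : G.Plan i) (I : Info i) (hπ : ¬ π.Reaches I) :
    ∃ σ : (Σ J : Info i, G.Choice J), G.IsCut I σ.1 σ.2 ∧ π.ReachesVia σ.1 σ.2 := by
  obtain ⟨k, hk⟩ := G.infoset_nonempty i I
  have hk : G.InInfoset I k := hk
  have hdev : ¬ π.PlaysTo k := fun h => hπ ⟨k, hk, h⟩
  have hkn : k ∈ G.nodes := by
    obtain ⟨a, ha⟩ := hk.1
    exact G.parent_mem a k ha
  -- the first deviation of the plan from the path to `k`
  have first : ∀ m : List Act, ¬ π.PlaysTo m →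
      ∃ (J : Info i) (h : List Act) (b : Act), G.InInfoset J h ∧ (b :: h) <:+ m ∧
        π.PlaysTo h ∧ (π J).1 ≠ b := by
    intro m
    induction m with
    | nil =>
      intro h
      exact absurd (fun J l a _ hs => by simp at hs) h
    | cons b m ih =>
      intro h
      by_cases hm : π.PlaysTo m
      · have h2 : ∃ (J : Info i) (l : List Act) (a : Act), G.InInfoset J l ∧
            (a :: l) <:+ (b :: m) ∧ (π J).1 ≠ a := by
          by_contra hcon
          refine h fun J l a hJ hs => ?_
          by_contra hne
          exact hcon ⟨J, l, a, hJ, hs, hne⟩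
        obtain ⟨J, l, a, hJ, hs, hne⟩ := h2
        rcases List.suffix_cons_iff.1 hs with h3 | h3
        · obtain ⟨rfl, rfl⟩ := List.cons.inj h3
          exact ⟨J, l, a, hJ, hs, hm, hne⟩
        · exact absurd (hm J l a hJ h3) hne
      · obtain ⟨J, l, a, h1, h2, h3, h4⟩ := ih hm
        exact ⟨J, l, a, h1, h2.trans (List.suffix_cons _ _), h3, h4⟩
  obtain ⟨J, h, b, hJ, hs, hto, hne⟩ := first k hdev
  have hhk : h <:+ k := (List.suffix_cons b h).trans hs
  refine ⟨⟨J, π J⟩, ⟨⟨h, k, hJ, hk, hhk⟩, ?_, ?_⟩, ⟨h, hJ, hto⟩, rfl⟩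
  · rintro rfl
    exact hπ ⟨h, hJ, hto⟩
  · rintro ⟨h', k', hJ', hk', hs'⟩
    have hmem : ((⟨i, J⟩ : Σ i, Info i), (π J).1) ∈ experience G.label i k := by
      rw [G.perfect_recall i I k k' hk.1 hk.2 hk'.1 hk'.2]
      exact mem_experience_of_node hJ' hs'
    obtain ⟨h'', hJ'', hs''⟩ := node_of_mem_experience hkn hmem
    have heq := eq_of_inInfoset_of_suffix hJ hJ'' hhk ((List.suffix_cons _ _).trans hs'')
    subst heq
    have := (List.suffix_or_suffix_of_suffix hs hs'')
    have h3 : b :: h = (π J).1 :: h := by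
      rcases this with h1 | h1
      · exact h1.eq_of_length (by simp)
      · exact (h1.eq_of_length (by simp)).symm
    exact hne (List.cons.inj h3).1.symm

/-- The sequence `σ_I` in `Σ_i^c(I)` that is played by a plan which does not reach `I` (there is
exactly one, by perfect recall; it only depends on the actions at infosets preceding `I`). -/
def cutSequence (π : G.Plan i) (I : Info i) (hπ : ¬ π.Reaches I) :
    Σ J : Info i, G.Choice J :=
  (exists_cut π I hπ).choose

end Cut

/-- The regret minimizers that ICFR instantiates for all players: at every infoset `I` one
internal-regret minimizer, and one external-regret minimizer for every sequence `(J, a)` in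
`Σ_i^c(I)` (the values at other sequences are never used). -/
structure ICFRDevices (G : EFG P Info Act) where
  int : ∀ i (I : Info i), RegretMinimizer (G.Choice I)
  ext : ∀ i (I J : Info i), G.Choice J → RegretMinimizer (G.Choice I)

variable [∀ i, Fintype (Info i)] (G : EFG P Info Act) {i : P}

open Classical in
/-- The utility observed by the internal-regret minimizer of `I` when `π` is played. -/
def intUtility (π : G.JointPlan) (I : Info i) : G.Choice I → ℝ :=
  fun b => if (π i).Reaches I then G.localUtility π I b else 0

open Classical in
/-- The utility observed by the external-regret minimizer of `I` for `(J, a)` when `π` is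
played. -/
def extUtility (π : G.JointPlan) (I J : Info i) (a : G.Choice J) : G.Choice I → ℝ :=
  fun b => if (π i).ReachesVia J a then G.localUtility π I b else 0

open Classical in
/-- The past of the internal-regret minimizer of `I` before round `t`. -/
def intPast (play : ℕ → G.JointPlan) (t : ℕ) (I : Info i) :
    List (Option (G.Choice I) × (G.Choice I → ℝ)) :=
  (List.range t).map fun s =>
    (if (play s i).Reaches I then some (play s i I) else none, G.intUtility (play s) I)

open Classical in
/-- The past of the external-regret minimizer of `I` for `(J, a)` before round `t`. -/
def extPast (play : ℕ → G.JointPlan) (t : ℕ) (I J : Info i) (a : G.Choice J) :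
    List (Option (G.Choice I) × (G.Choice I → ℝ)) :=
  (List.range t).map fun s =>
    (if (play s i).ReachesVia J a then some (play s i I) else none, G.extUtility (play s) I J a)

variable {G}

open Classical in
/-- The law from which the action of player `i` at `I` is sampled in round `t`, given the plays
before round `t` and the actions of the plan of round `t` at the infosets preceding `I`. -/
def ICFRDevices.sampleLaw (dev : G.ICFRDevices) (play : ℕ → G.JointPlan) (t : ℕ) (I : Info i) :
    PMF (G.Choice I) :=
  if hI : (play t i).Reaches I then
    (dev.int i I).recommend (G.intPast play t I)
  else
    (dev.ext i I (cutSequence (play t i) I hI).1 (cutSequence (play t i) I hI).2).recommend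
      (G.extPast play t I (cutSequence (play t i) I hI).1 (cutSequence (play t i) I hI).2)

/-- The random plays `π 0, π 1, …` on a probability space are generated by all players running
ICFR with the given regret minimizers: each round, every player samples her plan top-down, one
action per infoset, so that (chain rule) the probability of every finite sequence of joint plans
is the product of the probabilities of all the sampled actions. -/
structure IsICFRRun [Fintype P] (dev : G.ICFRDevices) {Ω : Type*} [MeasurableSpace Ω]
    (ℙ : Measure Ω) (π : ℕ → Ω → G.JointPlan) : Prop where
  measurable : ∀ t q, MeasurableSet {ω | π t ω = q}
  law : ∀ (T : ℕ) (play : ℕ → G.JointPlan),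
    ℙ {ω | ∀ t < T, π t ω = play t} =
      ∏ t ∈ Finset.range T, ∏ i : P, ∏ I : Info i, dev.sampleLaw play t I (play t i I)

end ICFR

end EFG

end

/-! Both sides of the EFCE inequality are linear in `μ`, and the right one is linear in the
deviation law too, so deterministic deviations suffice. For a plan `π'` used from `I` on after the
recommendation `a`, the violation is the `μ`-average of `triggerGain`; under the empirical frequency
it is a time average. The task is thus to show that the cumulated trigger gains are sublinear.

By `infosetValue_sub_eq`, the gain at `I` in one round is the gain from changing only the action at
`I`, plus the gains at the infosets `K` that follow `π' I`. Over the rounds in which `(I, a)` is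
recommended, the first part is bounded by the internal regret at `I` for swapping `a` with `π' I`.
For the second part there are two cases. If `a = π' I`, these are exactly the rounds whose plan
reaches `K`; splitting them by the action recommended at `K` gives trigger gains at `K`, and
induction from the leaves upwards applies (`noRegret_triggerGain`). If `a ≠ π' I`, then `(I, a)`
cuts `K` off, and the external-regret minimizers for this one sequence, at `K` and at all infosets
below it, bound the gain (`noRegret_infosetValue_of_isCut`).

Hence almost surely the empirical frequencies are eventually `ε`-EFCEs for every `ε > 0`.
Compactness of the set of `ε`-EFCEs turns this into existence of an EFCE and convergence of the
distance. -/

namespace EFG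

/-! ### Consequences of perfect recall: successors, reachability and cut sequences. -/

section PerfectRecall

variable {P : Type*} {Info : P → Type*} {Act : Type*} {G : EFG P Info Act} {i : P}

theorem InInfoset.mem_nodes {I : Info i} {k : List Act} (hk : G.InInfoset I k) : k ∈ G.nodes := by
  obtain ⟨a, ha⟩ := hk.1
  exact G.parent_mem a k ha

/-- Two nodes of an infoset are preceded by the same moves of its player. -/
theorem InInfoset.exists_node_of_suffix {I J : Info i} {h k k' : List Act} {a : Act}
    (hk : G.InInfoset I k) (hk' : G.InInfoset I k') (hJ : G.InInfoset J h)
    (hs : (a :: h) <:+ k) : ∃ h', G.InInfoset J h' ∧ (a :: h') <:+ k' := by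
  refine node_of_mem_experience hk'.mem_nodes ?_
  rw [← G.perfect_recall i I k k' hk.1 hk.2 hk'.1 hk'.2]
  exact mem_experience_of_node hJ hs

theorem exists_cons_suffix {α : Type*} {h k : List α} (hs : h <:+ k) (hne : h ≠ k) :
    ∃ b, (b :: h) <:+ k := by
  obtain ⟨l, rfl⟩ := hs
  rcases List.eq_nil_or_concat l with rfl | ⟨l, b, rfl⟩
  · exact absurd (by simp) hne
  · exact ⟨b, l, by simp⟩

theorem cons_eq_of_suffix {α : Type*} {a b : α} {h k : List α} (ha : (a :: h) <:+ k)
    (hb : (b :: h) <:+ k) : a = b := by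
  rcases List.suffix_or_suffix_of_suffix ha hb with h1 | h1
  · exact (List.cons.inj (h1.eq_of_length (by simp))).1
  · exact (List.cons.inj (h1.eq_of_length (by simp))).1.symm

theorem rank_lt_of_suffix {I J : Info i} {h k : List Act} (hI : G.InInfoset I h)
    (hJ : G.InInfoset J k) (hs : h <:+ k) (hne : h ≠ k) : G.rank I < G.rank J := by
  obtain ⟨b, hb⟩ := exists_cons_suffix hs hne
  have := (experience_suffix G.label i hb).length_le
  rw [G.experience_cons hI, List.length_cons] at this
  rw [G.rank_eq hI, G.rank_eq hJ]
  omega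

theorem rank_le_of_suffix {I J : Info i} {h k : List Act} (hI : G.InInfoset I h)
    (hJ : G.InInfoset J k) (hs : h <:+ k) : G.rank I ≤ G.rank J := by
  rw [G.rank_eq hI, G.rank_eq hJ]
  exact (experience_suffix G.label i hs).length_le

theorem InInfoset.unique {I J : Info i} {h : List Act} (hI : G.InInfoset I h)
    (hJ : G.InInfoset J h) : I = J := by
  have := hI.2.symm.trans hJ.2
  simpa using this

theorem experience_eq_of_no_infoset {h k : List Act} (hs : h <:+ k) (hk : k ∈ G.nodes)
    (hno : ∀ m, h <:+ m → m <:+ k → m ≠ k → ∀ K : Info i, ¬ G.InInfoset K m) :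
    experience G.label i k = experience G.label i h := by
  obtain ⟨l, rfl⟩ := hs
  induction l with
  | nil => rfl
  | cons b l ih =>
    have hl : l ++ h ∈ G.nodes := G.parent_mem b _ hk
    have hsuf : (l ++ h) <:+ (b :: l ++ h) := List.suffix_cons _ _
    have ih' := ih hl fun m h1 h2 h3 => hno m h1 (h2.trans hsuf) (by
      rintro rfl
      have := h2.length_le
      simp at this)
    rw [List.cons_append, experience]
    split
    · exact ih'
    · rename_i K hK
      split
      · rename_i hKi
        obtain ⟨j, K⟩ := K
        subst hKi
        exact absurd ⟨⟨b, hk⟩, hK⟩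
          (hno (l ++ h) (List.suffix_append _ _) hsuf (by simp) K)
      · exact ih'

/-- The only own move gained on the way from `I` to `J` is the one at `I`. Since all successors
share one rank and rank strictly increases along paths, no path meets two of them; this is what
makes their terminal sets disjoint. -/
theorem IsSucc.rank_eq {I J : Info i} {a : G.Choice I} (hJ : G.IsSucc I a J) :
    G.rank J = G.rank I + 1 := by
  obtain ⟨h, k, hI, hk, hs, hno⟩ := hJ
  rw [G.rank_eq hI, G.rank_eq hk, experience_eq_of_no_infoset hs hk.mem_nodes hno,
    G.experience_cons hI, List.length_cons]

/-- `IsSucc` provides a single pair of nodes; perfect recall carries its move at `I` over to every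
node of `J`. -/
theorem IsSucc.exists_node {I J : Info i} {a : G.Choice I} (hJ : G.IsSucc I a J) {k : List Act}
    (hk : G.InInfoset J k) : ∃ h, G.InInfoset I h ∧ (a.1 :: h) <:+ k := by
  obtain ⟨h', k', hI, hk', hs, -⟩ := hJ
  exact hk'.exists_node_of_suffix hk hI hs

theorem IsSucc.eq_of_suffix {I J J' : Info i} {a : G.Choice I} (hJ : G.IsSucc I a J)
    (hJ' : G.IsSucc I a J') {k k' z : List Act} (hk : G.InInfoset J k) (hk' : G.InInfoset J' k')
    (hs : k <:+ z) (hs' : k' <:+ z) : J = J' := by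
  have h1 := hJ.rank_eq
  have h2 := hJ'.rank_eq
  by_cases hne : k = k'
  · subst hne
    exact hk.unique hk'
  · rcases List.suffix_or_suffix_of_suffix hs hs' with h3 | h3
    · have := rank_lt_of_suffix hk hk' h3 hne
      omega
    · have := rank_lt_of_suffix hk' hk h3 (Ne.symm hne)
      omega

/-- The first infoset of the player on a path that leaves `I` by `a` immediately follows `I`. -/
theorem exists_isSucc_of_node {I K : Info i} {a : G.Choice I} {h z m : List Act}
    (hI : G.InInfoset I h) (hK : G.InInfoset K m) (hm : (a.1 :: h) <:+ m) (hz : m <:+ z) :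
    ∃ J k, G.IsSucc I a J ∧ G.InInfoset J k ∧ k <:+ z := by
  induction hn : m.length using Nat.strong_induction_on generalizing m K with
  | _ n ih =>
    by_cases hno : ∀ m', (a.1 :: h) <:+ m' → m' <:+ m → m' ≠ m → ∀ K : Info i,
        ¬ G.InInfoset K m'
    · exact ⟨K, m, ⟨h, m, hI, hK, hm, hno⟩, hK, hz⟩
    · push Not at hno
      obtain ⟨m', h1, h2, h3, K', hK'⟩ := hno
      refine ih m'.length ?_ hK' h1 (h2.trans hz) rfl
      subst hn
      exact lt_of_le_of_ne h2.length_le fun he => h3 (h2.eq_of_length he)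

namespace Plan

theorem PlaysTo.mono {π : G.Plan i} {k z : List Act} (hz : π.PlaysTo z) (hs : k <:+ z) :
    π.PlaysTo k := fun I m a hI hm => hz I m a hI (hm.trans hs)

/-- All nodes of an infoset are preceded by the same own moves, so a plan that plays to one of them
plays to all. -/
theorem Reaches.playsTo {π : G.Plan i} {I : Info i} {k : List Act} (hπ : π.Reaches I)
    (hk : G.InInfoset I k) : π.PlaysTo k := by
  obtain ⟨h, hI, hto⟩ := hπ
  intro J m a hJ hs
  obtain ⟨m', hm', hs'⟩ := hk.exists_node_of_suffix hI hJ hs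
  exact hto J m' a hm' hs'

theorem PlaysTo.extend {π : G.Plan i} {I : Info i} {h z : List Act} (hI : G.InInfoset I h)
    (hto : π.PlaysTo h) (hs : ((π I).1 :: h) <:+ z)
    (hno : ∀ m, ((π I).1 :: h) <:+ m → m <:+ z → m ≠ z → ∀ K : Info i, ¬ G.InInfoset K m) :
    π.PlaysTo z := by
  intro L m c hL hm
  rcases List.suffix_or_suffix_of_suffix hm hs with h1 | h1
  · rcases List.suffix_cons_iff.1 h1 with h2 | h2
    · obtain ⟨rfl, rfl⟩ := List.cons.inj h2
      rw [hL.unique hI]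
    · exact hto L m c hL h2
  · rcases List.suffix_cons_iff.1 h1 with h2 | h2
    · obtain ⟨h3, rfl⟩ := List.cons.inj h2
      rw [hL.unique hI, h3]
    · refine absurd hL (hno m h2 ((List.suffix_cons _ _).trans hm) ?_ L)
      rintro rfl
      have := hm.length_le
      simp at this

/-- The move `a` at `I` is the last own move before `J`, so nothing else is asked of the plan. This
identifies the rounds with recommendation `(I, a)` with the rounds in which `J` is reached. -/
theorem reaches_iff_of_isSucc {π : G.Plan i} {I J : Info i} {a : G.Choice I}
    (hJ : G.IsSucc I a J) : π.Reaches J ↔ π.ReachesVia I a := by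
  constructor
  · rintro ⟨k, hk, hto⟩
    obtain ⟨h, hI, hs⟩ := hJ.exists_node hk
    exact ⟨⟨h, hI, hto.mono ((List.suffix_cons _ _).trans hs)⟩, Subtype.ext (hto I h a hI hs)⟩
  · rintro ⟨hr, rfl⟩
    obtain ⟨h, k, hI, hk, hs, hno⟩ := hJ
    exact ⟨k, hk, (hr.playsTo hI).extend hI hs hno⟩

end Plan

/-- Every path to `K` leaves `I` by `b`. Hence `K` owns an external-regret minimizer for each
sequence `(I, a)` with `a ≠ b`. -/
theorem IsSucc.isCut_of_ne {I K : Info i} {a b : G.Choice I} (hK : G.IsSucc I b K)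
    (hab : a ≠ b) : G.IsCut K I a := by
  have hr := hK.rank_eq
  obtain ⟨h, k, hI, hk, hs, -⟩ := id hK
  refine ⟨⟨h, k, hI, hk, (List.suffix_cons _ _).trans hs⟩, ?_, ?_⟩
  · rintro rfl
    omega
  · rintro ⟨h', k', hI', hk', hs'⟩
    obtain ⟨h₂, hI₂, hs₂⟩ := hK.exists_node hk'
    have := eq_of_inInfoset_of_suffix hI' hI₂ ((List.suffix_cons _ _).trans hs')
      ((List.suffix_cons _ _).trans hs₂)
    subst this
    exact hab (Subtype.ext (cons_eq_of_suffix hs' hs₂))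

/-- A sequence that cuts `I` off cuts off everything below `I`, so a single sequence serves a whole
induction down the tree. -/
theorem IsCut.of_isSucc {I J K : Info i} {a : G.Choice J} {b : G.Choice I}
    (hI : G.IsCut I J a) (hK : G.IsSucc I b K) : G.IsCut K J a := by
  obtain ⟨⟨h, k, hJh, hIk, hhk⟩, hne, hcut⟩ := hI
  have hr := hK.rank_eq
  have hhk' : h ≠ k := by
    rintro rfl
    exact hne (hJh.unique hIk)
  have hlt := rank_lt_of_suffix hJh hIk hhk hhk'
  refine ⟨?_, ?_, ?_⟩
  · obtain ⟨h₂, k₂, hI₂, hK₂, hs₂, -⟩ := hK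
    obtain ⟨c, hc⟩ := exists_cons_suffix hhk hhk'
    obtain ⟨h', hJ', hs'⟩ := hIk.exists_node_of_suffix hI₂ hJh hc
    exact ⟨h', k₂, hJ', hK₂, (List.suffix_cons _ _).trans <| hs'.trans <|
      (List.suffix_cons _ _).trans hs₂⟩
  · rintro rfl
    omega
  · rintro ⟨h', k', hJ', hK', hs'⟩
    obtain ⟨h₂, hI₂, hs₂⟩ := hK.exists_node hK'
    -- A path to `K` that plays `a` at `J` also passes a node of `I`. If the move at `J` comes
    -- first, it leads to `I` after all; otherwise `I` weakly precedes `J`, against the strict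
    -- inequality of ranks.
    rcases List.suffix_or_suffix_of_suffix hs' ((List.suffix_cons _ _).trans hs₂) with h1 | h1
    · exact hcut ⟨h', h₂, hJ', hI₂, h1⟩
    · rcases List.suffix_cons_iff.1 h1 with h2 | h2
      · exact hcut ⟨h', h₂, hJ', hI₂, h2 ▸ List.suffix_refl _⟩
      · have := rank_le_of_suffix hI₂ hJ' h2
        omega

theorem rank_induction {motive : Info i → Prop}
    (step : ∀ I, (∀ J, G.rank I < G.rank J → motive J) → motive I) (I : Info i) : motive I := by
  induction hn : G.height - G.rank I using Nat.strong_induction_on generalizing I with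
  | _ n ih =>
    refine step I fun J hJ => ih (G.height - G.rank J) ?_ J rfl
    have := G.rank_le_height J
    omega

end PerfectRecall

/-! ### Local values as sums over terminal nodes. -/

section Value

variable {P : Type*} {Info : P → Type*} {Act : Type*} {G : EFG P Info Act} {i : P}

theorem mem_terminalsFrom {I : Info i} {z : List Act} :
    z ∈ G.terminalsFrom I ↔ z ∈ G.terminals ∧ ∃ h, G.InInfoset I h ∧ h <:+ z := by
  simp [terminalsFrom]

theorem mem_terminalsVia {I : Info i} {a : G.Choice I} {z : List Act} :
    z ∈ G.terminalsVia I a ↔ z ∈ G.terminals ∧ ∃ h, G.InInfoset I h ∧ (a.1 :: h) <:+ z := by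
  simp [terminalsVia]

theorem InInfoset.ne_of_mem_terminals {I : Info i} {h z : List Act} (hI : G.InInfoset I h)
    (hz : z ∈ G.terminals) : h ≠ z := by
  classical
  rintro rfl
  obtain ⟨a, ha⟩ := hI.1
  exact (Finset.mem_filter.1 hz).2 a ha

theorem terminalsVia_subset (I : Info i) (a : G.Choice I) :
    G.terminalsVia I a ⊆ G.terminalsFrom I := by
  intro z hz
  obtain ⟨hz, h, hI, hs⟩ := mem_terminalsVia.1 hz
  exact mem_terminalsFrom.2 ⟨hz, h, hI, (List.suffix_cons _ _).trans hs⟩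

theorem IsSucc.terminalsFrom_subset {I J : Info i} {a : G.Choice I} (hJ : G.IsSucc I a J) :
    G.terminalsFrom J ⊆ G.terminalsVia I a := by
  intro z hz
  obtain ⟨hz, k, hk, hs⟩ := mem_terminalsFrom.1 hz
  obtain ⟨h, hI, hs'⟩ := hJ.exists_node hk
  exact mem_terminalsVia.2 ⟨hz, h, hI, hs'.trans hs⟩

theorem Plan.PlaysTo.mem_terminalsVia {π : G.Plan i} {I : Info i} {z : List Act}
    (hto : π.PlaysTo z) (hz : z ∈ G.terminalsFrom I) : z ∈ G.terminalsVia I (π I) := by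
  obtain ⟨hz, h, hI, hs⟩ := mem_terminalsFrom.1 hz
  obtain ⟨b, hb⟩ := exists_cons_suffix hs (hI.ne_of_mem_terminals hz)
  refine EFG.mem_terminalsVia.2 ⟨hz, h, hI, ?_⟩
  rwa [hto I h b hI hb]

theorem Plan.PlaysTo.reachesVia {π : G.Plan i} {I : Info i} {a : G.Choice I} {z : List Act}
    (hto : π.PlaysTo z) (hz : z ∈ G.terminalsVia I a) : π.ReachesVia I a := by
  obtain ⟨-, h, hI, hs⟩ := EFG.mem_terminalsVia.1 hz
  exact ⟨⟨h, hI, hto.mono ((List.suffix_cons _ _).trans hs)⟩, Subtype.ext (hto I h _ hI hs)⟩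

open Classical in
theorem sum_terminalsFrom_eq_sum_terminalsVia (π' : G.Plan i) (I : Info i) (w : List Act → ℝ) :
    ∑ z ∈ G.terminalsFrom I, (if π'.PlaysTo z then w z else 0) =
      ∑ z ∈ G.terminalsVia I (π' I), if π'.PlaysTo z then w z else 0 := by
  refine (Finset.sum_subset (terminalsVia_subset I _) fun z hz hz' => if_neg fun hto => ?_).symm
  exact hz' (hto.mem_terminalsVia hz)

theorem JointPlan.forall_playsTo_iff {π : G.JointPlan} {z : List Act} (i : P) :
    (∀ j, (π j).PlaysTo z) ↔ (π i).PlaysTo z ∧ π.OpponentsPlayTo i z := by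
  refine ⟨fun h => ⟨h i, fun j _ => h j⟩, fun h j => ?_⟩
  by_cases hj : j = i
  · exact hj ▸ h.1
  · exact h.2 j hj

variable [∀ i, Fintype (Info i)]

theorem mem_succs {I J : Info i} {a : G.Choice I} : J ∈ G.succs I a ↔ G.IsSucc I a J := by
  simp [succs]

theorem Plan.Reaches.playsTo_of_no_succ {π : G.Plan i} {I : Info i} {z : List Act}
    (hπ : π.Reaches I) (hz : z ∈ G.terminalsVia I (π I))
    (hno : ∀ J ∈ G.succs I (π I), z ∉ G.terminalsFrom J) : π.PlaysTo z := by
  obtain ⟨hzt, h, hI, hs⟩ := mem_terminalsVia.1 hz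
  refine (hπ.playsTo hI).extend hI hs fun m hm hmz _ K hK => ?_
  obtain ⟨J, k, hJ, hk, hkz⟩ := exists_isSucc_of_node hI hK hm hmz
  exact hno J (mem_succs.2 hJ) (mem_terminalsFrom.2 ⟨hzt, k, hk, hkz⟩)

theorem infosetValue_eq (π : G.JointPlan) (π' : G.Plan i) (I : Info i) :
    G.infosetValue π π' I =
      G.immediateUtility π I (π' I) + ∑ J ∈ G.succs I (π' I), G.infosetValue π π' J := by
  rw [infosetValue, Finset.sum_attach _ fun J => G.infosetValue π π' J]

theorem infosetValue_self (π : G.JointPlan) (I : Info i) :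
    G.infosetValue π (π i) I = G.localUtility π I (π i I) := by
  rw [infosetValue_eq, localUtility]

/-- `localUtility` continues with `π i` below `I`, so the continuation values of `π i` after `π' I`
are added and subtracted. The identity needs no reachability, and hence also serves at infosets that
`π i` cuts off. -/
theorem infosetValue_sub_eq (π : G.JointPlan) (π' : G.Plan i) (I : Info i) :
    G.infosetValue π π' I - G.infosetValue π (π i) I =
      (G.localUtility π I (π' I) - G.localUtility π I (π i I)) +
        ∑ J ∈ G.succs I (π' I), (G.infosetValue π π' J - G.infosetValue π (π i) J) := by
  rw [infosetValue_self, infosetValue_eq, Finset.sum_sub_distrib, localUtility.eq_def G π I (π' I)]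
  ring

open Classical in
/-- The utility attainable at a reached infoset, as a sum over the terminal nodes. -/
theorem infosetValue_eq_sum (π : G.JointPlan) {π' : G.Plan i} {I : Info i}
    (hπ : π'.Reaches I) :
    G.infosetValue π π' I = ∑ z ∈ G.terminalsFrom I, if π'.PlaysTo z then
      (if π.OpponentsPlayTo i z then 1 else 0) * G.chanceReach z * G.payoff i z else 0 := by
  induction hn : G.height - G.rank I using Nat.strong_induction_on generalizing I with
  | _ n ih =>
    -- Terminal nodes with no later own infoset give the immediate utility; the others are
    -- partitioned by the sets `Z(J)` of the successors `J`.
    rw [sum_terminalsFrom_eq_sum_terminalsVia, infosetValue_eq,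
      ← Finset.sum_filter_add_sum_filter_not (G.terminalsVia I (π' I))
        (fun z => ∀ J ∈ G.succs I (π' I), z ∉ G.terminalsFrom J)]
    congr 1
    · refine Finset.sum_congr rfl fun z hz => ?_
      rw [Finset.mem_filter] at hz
      rw [if_pos (hπ.playsTo_of_no_succ hz.1 hz.2)]
    · have hunion : (G.terminalsVia I (π' I)).filter
          (fun z => ¬ ∀ J ∈ G.succs I (π' I), z ∉ G.terminalsFrom J) =
          (G.succs I (π' I)).biUnion G.terminalsFrom := by
        ext z
        simp only [Finset.mem_filter, Finset.mem_biUnion]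
        push Not
        exact ⟨fun h => h.2, fun ⟨J, hJ, hz⟩ =>
          ⟨(mem_succs.1 hJ).terminalsFrom_subset hz, J, hJ, hz⟩⟩
      rw [hunion, Finset.sum_biUnion]
      · refine Finset.sum_congr rfl fun J hJ => ?_
        have hJ' := mem_succs.1 hJ
        have h1 := G.rank_lt_of_isSucc hJ'
        have h2 := G.rank_le_height J
        exact ih (G.height - G.rank J) (by omega)
          ((Plan.reaches_iff_of_isSucc hJ').2 ⟨hπ, rfl⟩) rfl
      · intro J hJ J' hJ' hne
        refine Finset.disjoint_left.2 fun z hz hz' => hne ?_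
        obtain ⟨-, k, hk, hs⟩ := mem_terminalsFrom.1 hz
        obtain ⟨-, k', hk', hs'⟩ := mem_terminalsFrom.1 hz'
        exact (mem_succs.1 hJ).eq_of_suffix (mem_succs.1 hJ') hk hk' hs hs'

open Classical in
/-- The gain of player `i` from deviating to the plan `π'` when she is recommended `a` at `I`
and the joint plan `π` is played. -/
noncomputable def triggerGain (G : EFG P Info Act) (π : G.JointPlan) (π' : G.Plan i) (I : Info i)
    (a : G.Choice I) : ℝ :=
  if (π i).ReachesVia I a then G.infosetValue π π' I - G.infosetValue π (π i) I else 0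

end Value

/-! ### The equilibrium gap as an average of trigger gains. -/

section Gap

variable {P : Type*} [Fintype P] {Info : P → Type*} [∀ i, Fintype (Info i)] {Act : Type*}
  {G : EFG P Info Act} {i : P}

open Classical in
theorem sum_reachProb_eq (μ : G.JointPlan → ℝ) (I : Info i) (a : G.Choice I) :
    ∑ z ∈ G.terminalsVia I a, G.reachProb μ z * G.payoff i z =
      ∑ π, μ π * if (π i).ReachesVia I a then G.infosetValue π (π i) I else 0 := by
  have h1 : ∀ z ∈ G.terminalsVia I a, G.reachProb μ z * G.payoff i z =
      ∑ π, μ π * (if (π i).PlaysTo z then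
        (if π.OpponentsPlayTo i z then 1 else 0) * G.chanceReach z * G.payoff i z else 0) := by
    intro z _
    rw [reachProb, Finset.sum_filter, Finset.sum_mul, Finset.sum_mul]
    refine Finset.sum_congr rfl fun π _ => ?_
    simp only [JointPlan.forall_playsTo_iff i]
    split_ifs <;> simp_all [mul_assoc]
  rw [Finset.sum_congr rfl h1, Finset.sum_comm]
  refine Finset.sum_congr rfl fun π _ => ?_
  rw [← Finset.mul_sum]
  congr 1
  split_ifs with hv
  · rw [infosetValue_eq_sum π hv.1, sum_terminalsFrom_eq_sum_terminalsVia, hv.2]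
  · exact Finset.sum_eq_zero fun z hz => if_neg fun hto => hv (hto.reachesVia hz)

open Classical in
-- The support condition is needed because `infosetValue` ignores the moves of `π'` before `I`,
-- whereas `PlaysTo` tests them; the two agree only for plans that reach `I`.
theorem sum_triggerProb_eq (μ : G.JointPlan → ℝ) (I : Info i) (a : G.Choice I)
    {μ' : G.Plan i → ℝ} (hμ' : ∀ π', ¬ π'.Reaches I → μ' π' = 0) :
    ∑ z ∈ G.terminalsFrom I, G.triggerProb μ I a μ' z * G.payoff i z =
      ∑ π', μ' π' * ∑ π, μ π *
        if (π i).ReachesVia I a then G.infosetValue π π' I else 0 := by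
  have h1 : ∀ z ∈ G.terminalsFrom I, G.triggerProb μ I a μ' z * G.payoff i z =
      ∑ π', ∑ π, μ' π' * (μ π * if (π i).ReachesVia I a then (if π'.PlaysTo z then
        (if π.OpponentsPlayTo i z then 1 else 0) * G.chanceReach z * G.payoff i z else 0)
        else 0) := by
    intro z _
    rw [triggerProb, Finset.sum_filter, Finset.sum_filter, mul_comm (∑ π, _), Finset.sum_mul,
      Finset.sum_mul, Finset.sum_mul]
    refine Finset.sum_congr rfl fun π' _ => ?_
    rw [Finset.mul_sum, Finset.sum_mul, Finset.sum_mul]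
    refine Finset.sum_congr rfl fun π _ => ?_
    split_ifs <;> simp_all [mul_assoc]
  rw [Finset.sum_congr rfl h1, Finset.sum_comm]
  refine Finset.sum_congr rfl fun π' _ => ?_
  rw [Finset.sum_comm, Finset.mul_sum]
  refine Finset.sum_congr rfl fun π _ => ?_
  by_cases hr : π'.Reaches I
  · rw [← Finset.mul_sum, ← Finset.mul_sum, infosetValue_eq_sum π hr]
    split_ifs <;> simp
  · simp [hμ' π' hr]

/-- A distribution is an `ε`-EFCE if no deterministic deviation of a trigger agent gains more than
`ε`. -/
theorem isApproxEFCE_of_triggerGain_le {ε : ℝ} {μ : G.JointPlan → ℝ}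
    (hμ : μ ∈ stdSimplex ℝ G.JointPlan)
    (h : ∀ (i : P) (I : Info i) (a : G.Choice I) (π' : G.Plan i),
      ∑ π, μ π * G.triggerGain π π' I a ≤ ε) : G.IsApproxEFCE ε μ := by
  classical
  refine ⟨hμ, fun i I a μ' hμ' hsupp => ?_⟩
  rw [sum_reachProb_eq, sum_triggerProb_eq μ I a hsupp]
  have h1 : ∑ π', μ' π' * ∑ π, μ π * G.triggerGain π π' I a ≤ ε := by
    calc ∑ π', μ' π' * ∑ π, μ π * G.triggerGain π π' I a
        ≤ ∑ π', μ' π' * ε :=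
          Finset.sum_le_sum fun π' _ => mul_le_mul_of_nonneg_left (h i I a π') (hμ'.1 π')
      _ = ε := by rw [← Finset.sum_mul, hμ'.2, one_mul]
  have h2 : ∀ π', ∑ π, μ π * G.triggerGain π π' I a =
      (∑ π, μ π * if (π i).ReachesVia I a then G.infosetValue π π' I else 0) -
      ∑ π, μ π * if (π i).ReachesVia I a then G.infosetValue π (π i) I else 0 := by
    intro π'
    rw [← Finset.sum_sub_distrib]
    refine Finset.sum_congr rfl fun π _ => ?_
    rw [triggerGain]
    split_ifs <;> ring
  simp only [h2, mul_sub, Finset.sum_sub_distrib] at h1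
  rw [← Finset.sum_mul, hμ'.2, one_mul] at h1
  linarith

theorem isClosed_setOf_isApproxEFCE (G : EFG P Info Act) (ε : ℝ) :
    IsClosed {μ | G.IsApproxEFCE ε μ} := by
  classical
  simp only [IsApproxEFCE, Set.ofPred_and, Set.ofPred_forall]
  refine (isClosed_stdSimplex _ _).inter ?_
  refine isClosed_iInter fun i => isClosed_iInter fun I => isClosed_iInter fun a =>
    isClosed_iInter fun μ' => isClosed_iInter fun _ => isClosed_iInter fun _ => ?_
  refine isClosed_le ?_ ?_ <;> simp only [reachProb, triggerProb] <;> fun_prop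

theorem isApproxEFCE_zero_of_forall {μ : G.JointPlan → ℝ}
    (h : ∀ ε : ℝ, 0 < ε → G.IsApproxEFCE ε μ) : G.IsApproxEFCE 0 μ := by
  refine ⟨(h 1 one_pos).1, fun i I a μ' hμ' hsupp => ?_⟩
  rw [ge_iff_le, sub_zero]
  refine le_of_forall_pos_le_add fun ε hε => ?_
  have := (h ε hε).2 i I a μ' hμ' hsupp
  linarith

end Gap

end EFG

/-! ### Calculus of sublinear regret. -/

section Regret

theorem NoRegret.mono {R S : ℕ → ℝ} (hS : NoRegret S) (h : ∀ T, R T ≤ S T) : NoRegret R :=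
  fun ε hε => (hS ε hε).mono fun T hT => (h T).trans hT

theorem NoRegret.zero : NoRegret fun _ => 0 :=
  fun ε hε => Eventually.of_forall fun T => by positivity

theorem NoRegret.add {R S : ℕ → ℝ} (hR : NoRegret R) (hS : NoRegret S) :
    NoRegret fun T => R T + S T := by
  intro ε hε
  filter_upwards [hR (ε / 2) (by positivity), hS (ε / 2) (by positivity)] with T h1 h2
  linarith

theorem NoRegret.sum {ι : Type*} {R : ι → ℕ → ℝ} (s : Finset ι) (h : ∀ j ∈ s, NoRegret (R j)) :
    NoRegret fun T => ∑ j ∈ s, R j T := by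
  classical
  induction s using Finset.induction_on with
  | empty => simpa using NoRegret.zero
  | insert j s hj ih =>
    simp only [Finset.sum_insert hj]
    exact (h j (by simp)).add (ih fun k hk => h k (by simp [hk]))

theorem sum_sub_le_externalRegret {A : Type*} [Finite A] (x : ℕ → A) (u : ℕ → A → ℝ) (T : ℕ)
    (a : A) : ∑ t ∈ Finset.range T, (u t a - u t (x t)) ≤ externalRegret x u T := by
  rw [Finset.sum_sub_distrib, externalRegret]
  exact sub_le_sub_right (le_ciSup (f := fun a => ∑ t ∈ Finset.range T, u t a)
    (Set.finite_range _).bddAbove a) _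

open Classical in
theorem sum_sub_le_internalRegret {A : Type*} [Finite A] (x : ℕ → A) (u : ℕ → A → ℝ) (T : ℕ)
    (a b : A) :
    ∑ t ∈ Finset.range T, (if x t = a then u t b - u t a else 0) ≤ internalRegret x u T := by
  unfold internalRegret
  exact le_ciSup (f := fun ab : A × A => ∑ t ∈ Finset.range T,
    if x t = ab.1 then u t ab.2 - u t ab.1 else 0) (Set.finite_range _).bddAbove (a, b)

end Regret

namespace EFG

/-! ### Decomposition of trigger gains into local regrets. -/

section Decomposition

variable {P : Type*} {Info : P → Type*} [∀ i, Fintype (Info i)] {Act : Type*}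
  {G : EFG P Info Act} {i : P}

open Classical in
/-- After a sequence that cuts `I` off, the external-regret minimizers of `I` and of the
subsequent infosets bound the regret at `I` for not having followed another plan from `I` on. -/
theorem noRegret_infosetValue_of_isCut {play : ℕ → G.JointPlan}
    (hext : ∀ (I J : Info i) (a : G.Choice J), G.IsCut I J a →
      NoRegret (externalRegret (fun t => play t i I) fun t => G.extUtility (play t) I J a))
    (π' : G.Plan i) {J : Info i} (a : G.Choice J) (I : Info i) (hcut : G.IsCut I J a) :
    NoRegret fun T => ∑ t ∈ Finset.range T, if (play t i).ReachesVia J a then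
      G.infosetValue (play t) π' I - G.infosetValue (play t) (play t i) I else 0 := by
  induction I using G.rank_induction with
  | step I ih =>
    refine ((hext I J a hcut).add (NoRegret.sum (G.succs I (π' I)) fun K hK =>
      ih K (G.rank_lt_of_isSucc (mem_succs.1 hK)) (hcut.of_isSucc (mem_succs.1 hK)))).mono
      fun T => ?_
    rw [Finset.sum_comm]
    refine le_trans (le_of_eq ?_) (add_le_add_left
      (sum_sub_le_externalRegret _ _ T (π' I)) _)
    rw [← Finset.sum_add_distrib]
    refine Finset.sum_congr rfl fun t _ => ?_
    -- In rounds without the sequence the device observes the zero utility, so its regret over all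
    -- rounds counts only the relevant ones.
    simp only [extUtility]
    split_ifs
    · exact infosetValue_sub_eq _ _ _
    · simp

theorem sum_triggerGain (π : G.JointPlan) (π' : G.Plan i) (I : Info i)
    [Fintype (G.Choice I)] (hr : (π i).Reaches I) :
    ∑ b, G.triggerGain π π' I b = G.infosetValue π π' I - G.infosetValue π (π i) I := by
  classical
  simp [triggerGain, Plan.ReachesVia, hr]

/-- The gains of all the trigger agents are asymptotically sublinear. -/
theorem noRegret_triggerGain {play : ℕ → G.JointPlan}
    (hint : ∀ I : Info i,
      NoRegret (internalRegret (fun t => play t i I) fun t => G.intUtility (play t) I))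
    (hext : ∀ (I J : Info i) (a : G.Choice J), G.IsCut I J a →
      NoRegret (externalRegret (fun t => play t i I) fun t => G.extUtility (play t) I J a))
    (π' : G.Plan i) (I : Info i) (a : G.Choice I) :
    NoRegret fun T => ∑ t ∈ Finset.range T, G.triggerGain (play t) π' I a := by
  classical
  induction I using G.rank_induction with
  | step I ih =>
    have hsucc : ∀ K ∈ G.succs I (π' I), NoRegret fun T => ∑ t ∈ Finset.range T,
        if (play t i).ReachesVia I a then
          G.infosetValue (play t) π' K - G.infosetValue (play t) (play t i) K else 0 := by
      intro K hK
      have hK := mem_succs.1 hK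
      by_cases ha : a = π' I
      · refine (NoRegret.sum Finset.univ fun b _ => ih K (G.rank_lt_of_isSucc hK) b).mono
          fun T => ?_
        rw [Finset.sum_comm]
        refine Finset.sum_le_sum fun t _ => ?_
        -- When the deviation keeps the action `a`, the rounds in question are those whose plan
        -- reaches `K`, and exactly one trigger agent of `K` is then active.
        rw [ha, ← Plan.reaches_iff_of_isSucc hK]
        split_ifs with hr
        · rw [sum_triggerGain _ _ _ hr]
        · exact le_of_eq (Finset.sum_eq_zero fun b _ => if_neg fun h => hr h.1).symm
      · exact noRegret_infosetValue_of_isCut hext π' a K (hK.isCut_of_ne ha)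
    refine ((hint I).add (NoRegret.sum _ hsucc)).mono fun T => ?_
    rw [Finset.sum_comm]
    refine le_trans (le_of_eq ?_) (add_le_add_left
      (sum_sub_le_internalRegret _ _ T a (π' I)) _)
    rw [← Finset.sum_add_distrib]
    refine Finset.sum_congr rfl fun t _ => ?_
    simp only [intUtility, triggerGain]
    by_cases hv : (play t i).ReachesVia I a
    · obtain ⟨hr, rfl⟩ := id hv
      simp only [if_pos hv, if_pos hr]
      exact infosetValue_sub_eq _ _ _
    · simp only [if_neg hv, Finset.sum_const_zero, add_zero]
      -- Without the recommendation `(I, a)` the internal-regret term vanishes for one of two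
      -- reasons: another action was recommended at `I`, or `I` was cut off and the observed utility
      -- is zero.
      by_cases hr : (play t i).Reaches I
      · rw [if_neg fun h => hv ⟨hr, h⟩]
      · simp [hr]

end Decomposition

/-! ### From sublinear gains to convergence, by compactness. -/

section Convergence

variable {P : Type*} [Fintype P] {Info : P → Type*} [∀ i, Fintype (Info i)] {Act : Type*}
  {G : EFG P Info Act}

theorem sum_empiricalFrequency_mul (play : ℕ → G.JointPlan) (T : ℕ) (f : G.JointPlan → ℝ) :
    ∑ π, G.empiricalFrequency play T π * f π = (∑ t ∈ Finset.range T, f (play t)) / T := by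
  classical
  rw [← Finset.sum_fiberwise (Finset.range T) play, Finset.sum_div]
  refine Finset.sum_congr rfl fun π _ => ?_
  rw [empiricalFrequency, Finset.sum_congr rfl fun t ht => by rw [(Finset.mem_filter.1 ht).2],
    Finset.sum_const, nsmul_eq_mul, div_mul_eq_mul_div]

theorem empiricalFrequency_mem_stdSimplex (play : ℕ → G.JointPlan) {T : ℕ} (hT : 0 < T) :
    G.empiricalFrequency play T ∈ stdSimplex ℝ G.JointPlan := by
  refine ⟨fun π => by unfold empiricalFrequency; positivity, ?_⟩
  have := sum_empiricalFrequency_mul play T fun _ => 1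
  have hT' : (T : ℝ) ≠ 0 := by positivity
  simpa [hT'] using this

theorem eventually_isApproxEFCE {play : ℕ → G.JointPlan}
    (h : ∀ (i : P) (I : Info i) (a : G.Choice I) (π' : G.Plan i),
      NoRegret fun T => ∑ t ∈ Finset.range T, G.triggerGain (play t) π' I a)
    {ε : ℝ} (hε : 0 < ε) : ∀ᶠ T in atTop, G.IsApproxEFCE ε (G.empiricalFrequency play T) := by
  -- There are finitely many deviations, so one threshold for `T` serves all of them.
  have hall : ∀ᶠ T in atTop, ∀ (i : P) (I : Info i) (a : G.Choice I) (π' : G.Plan i),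
      ∑ t ∈ Finset.range T, G.triggerGain (play t) π' I a ≤ ε * T := by
    simp only [eventually_all]
    exact fun i I a π' => h i I a π' ε hε
  filter_upwards [hall, eventually_gt_atTop 0] with T hT hpos
  refine isApproxEFCE_of_triggerGain_le (empiricalFrequency_mem_stdSimplex play hpos)
    fun i I a π' => ?_
  rw [sum_empiricalFrequency_mul play T fun π => G.triggerGain π π' I a,
    div_le_iff₀ (by positivity)]
  exact hT i I a π'

theorem isCompact_setOf_isApproxEFCE (G : EFG P Info Act) (ε : ℝ) :
    IsCompact {μ | G.IsApproxEFCE ε μ} :=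
  (isCompact_stdSimplex ℝ G.JointPlan).of_isClosed_subset (G.isClosed_setOf_isApproxEFCE ε)
    fun _ h => h.1

/-- A cluster point of distributions that are eventually `ε`-EFCEs for every `ε` is an EFCE. -/
theorem mem_efceSet_of_clusterPt {F : Filter (G.JointPlan → ℝ)}
    (hF : ∀ ε : ℝ, 0 < ε → ∀ᶠ μ in F, G.IsApproxEFCE ε μ) {μ : G.JointPlan → ℝ}
    (hμ : ClusterPt μ F) : μ ∈ G.efceSet :=
  isApproxEFCE_zero_of_forall fun ε hε =>
    (G.isClosed_setOf_isApproxEFCE ε).closure_subset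
      (mem_closure_iff_clusterPt.2 (hμ.mono (le_principal_iff.2 (hF ε hε))))

theorem exists_clusterPt_efceSet {F : Filter (G.JointPlan → ℝ)} [F.NeBot]
    (hF : ∀ ε : ℝ, 0 < ε → ∀ᶠ μ in F, G.IsApproxEFCE ε μ) :
    ∃ μ ∈ G.efceSet, ClusterPt μ F := by
  obtain ⟨μ, -, hμ⟩ := isCompact_setOf_isApproxEFCE G 1 (le_principal_iff.2 (hF 1 one_pos))
  exact ⟨μ, mem_efceSet_of_clusterPt hF hμ, hμ⟩

theorem tendsto_infDist_efceSet {F : Filter (G.JointPlan → ℝ)}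
    (hF : ∀ ε : ℝ, 0 < ε → ∀ᶠ μ in F, G.IsApproxEFCE ε μ) :
    Tendsto (fun μ => Metric.infDist μ G.efceSet) F (𝓝 0) := by
  refine tendsto_order.2 ⟨fun b hb => Eventually.of_forall fun μ =>
    hb.trans_le Metric.infDist_nonneg, fun δ hδ => ?_⟩
  by_contra hfar
  have hcl : IsClosed {μ | δ ≤ Metric.infDist μ G.efceSet} :=
    isClosed_le continuous_const (Metric.continuous_infDist_pt _)
  -- Were the distance frequently at least `δ`, the restriction of `F` to such points would be a
  -- proper filter. Its cluster point would be an EFCE and yet, by closedness, at distance at least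
  -- `δ` from the set of EFCEs.
  have hne : (F ⊓ 𝓟 {μ | δ ≤ Metric.infDist μ G.efceSet}).NeBot := by
    rw [← frequently_mem_iff_neBot]
    exact (not_eventually.1 hfar).mono fun μ hμ => not_lt.1 hμ
  obtain ⟨μ, hμ, hclus⟩ := exists_clusterPt_efceSet fun ε hε =>
    (hF ε hε).filter_mono (inf_le_left : F ⊓ 𝓟 {μ | δ ≤ Metric.infDist μ G.efceSet} ≤ F)
  have hmem : μ ∈ {μ | δ ≤ Metric.infDist μ G.efceSet} :=
    hcl.closure_subset (mem_closure_iff_clusterPt.2 (hclus.mono inf_le_right))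
  have h0 : δ ≤ Metric.infDist μ G.efceSet := hmem
  rw [Metric.infDist_zero_of_mem hμ] at h0
  exact absurd h0 (not_le.2 hδ)

end Convergence

end EFG

theorem theorem2 {P : Type*} [Fintype P] {Info : P → Type*} [∀ i, Fintype (Info i)]
    {Act : Type*} (G : EFG P Info Act) (dev : G.ICFRDevices)
    {Ω : Type*} [MeasurableSpace Ω] (ℙ : Measure Ω) [IsProbabilityMeasure ℙ]
    (π : ℕ → Ω → G.JointPlan) (hrun : EFG.IsICFRRun dev ℙ π)
    -- every local internal-regret minimizer has sublinear regret on the utilities it observes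
    (hint : ∀ (i : P) (I : Info i), ∀ᵐ ω ∂ℙ,
      NoRegret (internalRegret (fun t => π t ω i I) (fun t => G.intUtility (π t ω) I)))
    -- every local external-regret minimizer has sublinear regret on the utilities it observes
    (hext : ∀ (i : P) (I J : Info i) (a : G.Choice J), G.IsCut I J a → ∀ᵐ ω ∂ℙ,
      NoRegret (externalRegret (fun t => π t ω i I) (fun t => G.extUtility (π t ω) I J a))) :
    G.efceSet.Nonempty ∧
    ∀ᵐ ω ∂ℙ,
      (∀ ε : ℝ, 0 < ε → ∀ᶠ T in atTop, G.IsApproxEFCE ε (G.empiricalFrequency (fun t => π t ω) T)) ∧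
      Tendsto (fun T => Metric.infDist (G.empiricalFrequency (fun t => π t ω) T) G.efceSet)
        atTop (𝓝 0) := by
  have hplay : ∀ᵐ ω ∂ℙ, ∀ ε : ℝ, 0 < ε → ∀ᶠ T in atTop,
      G.IsApproxEFCE ε (G.empiricalFrequency (fun t => π t ω) T) := by
    have hext' : ∀ᵐ ω ∂ℙ, ∀ (i : P) (I J : Info i) (a : G.Choice J), G.IsCut I J a →
        NoRegret (externalRegret (fun t => π t ω i I)
          (fun t => G.extUtility (π t ω) I J a)) := by
      simp only [ae_all_iff]
      exact hext
    have hint' : ∀ᵐ ω ∂ℙ, ∀ (i : P) (I : Info i),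
        NoRegret (internalRegret (fun t => π t ω i I) (fun t => G.intUtility (π t ω) I)) := by
      simp only [ae_all_iff]
      exact hint
    filter_upwards [hint', hext'] with ω h1 h2
    exact fun ε hε => EFG.eventually_isApproxEFCE
      (fun i I a π' => EFG.noRegret_triggerGain (h1 i) (h2 i) π' I a) hε
  refine ⟨?_, hplay.mono fun ω hω => ⟨hω, ?_⟩⟩
  -- An almost sure event of a probability space is nonempty, so a single good run already yields an
  -- EFCE as a cluster point of its frequencies.
  · obtain ⟨ω, hω⟩ := hplay.exists
    obtain ⟨μ, hμ, -⟩ := EFG.exists_clusterPt_efceSet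
      (F := map (G.empiricalFrequency fun t => π t ω) atTop) hω
    exact ⟨μ, hμ⟩
  · exact (EFG.tendsto_infDist_efceSet
      (F := map (G.empiricalFrequency fun t => π t ω) atTop) hω).comp tendsto_map
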